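/- Let $k\ge 2$ and $n\ge 2k$ with $n$ even. Let $\mathfrak g=\mathfrak{so}(n+k,k)$ with Killing form $\kappa$, realised on $\mathbb R^{n+2k}$ with the quadratic form with Gram matrix $\begin{pmatrix}0&0&1_k\\0&1_n&0\\1_k&0&0\end{pmatrix}$; let $\mathfrak p\subset\mathfrak g$ be the stabilizer of the isotropic subspace spanned by the first $k$ basis vectors, with Levi factor $\mathfrak g_0=\mathfrak{gl}(k,\mathbb R)\oplus\mathfrak{so}(n)$ and nilradical $\mathfrak p_+$. Let $1\le i<j\le k$ and let $\lambda=(\lambda_1,\dots,\lambda_k)$ be a weight such that both $\lambda-\frac12(n-1,\dots,n-1)$ and $\lambda_{(ij)}-\frac12(n-1,\dots,n-1)$ are partitions whose Young diagrams are symmetric with respect to the main diagonal; here $\lambda_{(i)}$, $\lambda_{(j)}$, $\lambda_{(ij)}$ are obtained from $\lambda$ by adding $1$ to the $i$-th entry, to the $j$-th entry, and to both. Let $\mathrm V_\mu$ be the irreducible complex $\mathfrak{gl}(k,\mathbb R)$-module with highest weight $\mu$, let $\mathbb S_\pm$ be the half-spin modules of $\mathfrak{so}(n)$, and let $\mathbb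 T_\pm$ be the twistor module, that is, the kernel of Clifford multiplication $\mathbb C^n\otimes\mathbb S_\pm\to\mathbb S_\mp$. All tensor products below are $\mathfrak p$-modules on which $\mathfrak p_+$ acts trivially. For an invariant form $B=t\kappa$ with $t\neq 0$ real, the Curved Casimir operator $\mathcal C$ of the homogeneous model acts on $\mathfrak p$-equivariant functions on (open subsets of) the group by $\mathcal C f=\sum_a x_a.(x^a.f)$, where $(x_a)$, $(x^a)$ are $B$-dual bases of $\mathfrak g$ acting as left invariant vector fields; equivariance means $Z.f=-\rho(Z)f$ for all $Z\in\mathfrak p$. Then $\mathcal C$ acts by a real scalar on the sections of each of the bundles induced by $\mathrm V_\lambda\otimes\mathbb S_\pm$, $\mathrm V_{\lambda_{(i)}}\otimes\mathbb S_\mp$, $\mathrm V_{\lambda_{(j)}}\otimes\mathbb S_\mp$, $\mathrm V_{\lambda_{(i)}}\otimes\mathbb T_\pm$, $\mathrm V_{\lambda_{(j)}}\otimes\mathbb T_\pm$. Denote these scalars by $c_\lambda, c_i^{\mathbb S}, c_j^{\mathbb S}, c_i^{\mathbb T}, c_j^{\mathbb T}$ and put $\alpha_*^\bullet=c_\lambda-c_*^\bullet$.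 Then $$\alpha_i^{\mathbb S}=\frac1{2t}\cdot\frac{2(\lambda_j-\lambda_i)}{n+2k-2},\qquad \alpha_j^{\mathbb S}=\frac1{2t}\cdot\frac{2(\lambda_i-\lambda_j)}{n+2k-2},$$ $$\alpha_i^{\mathbb T}=\frac1{2t}\cdot\frac{2(\lambda_j-\lambda_i)-n}{n+2k-2},\qquad \alpha_j^{\mathbb T}=\frac1{2t}\cdot\frac{2(\lambda_i-\lambda_j)-n}{n+2k-2}.$$ In particular, for the normalization $B=\frac12\kappa$, that is $B(X,Y)=\frac{n+2k-2}2\operatorname{tr}(XY)$, the factor $\frac1{2t}$ is $1$. -/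

import Mathlib

open scoped Matrix TensorProduct ContDiff

attribute [local instance] LieRing.ofAssociativeRing
attribute [local instance] Matrix.normedAddCommGroup Matrix.normedSpace

noncomputable section

namespace KDirac

/-! ### The graded Lie algebra `so(n+k,k)` -/

/-- Index set of the preferred basis of `ℝ^{n+2k}`: blocks of sizes `k`, `n`, `k`. -/
abbrev Idx (n k : ℕ) : Type := Fin k ⊕ (Fin n ⊕ Fin k)

/-- Square real matrices of size `n+2k`. -/
abbrev Mat (n k : ℕ) : Type := Matrix (Idx n k) (Idx n k) ℝ

/-- Gram matrix of the quadratic form of signature `(n+k,k)`: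
block rows `(0,0,1)`, `(0,1,0)`, `(1,0,0)`. -/
def J (n k : ℕ) : Mat n k
  | .inl a, .inr (.inr b) => if a = b then 1 else 0
  | .inr (.inl a), .inr (.inl b) => if a = b then 1 else 0
  | .inr (.inr a), .inl b => if a = b then 1 else 0
  | _, _ => 0

/-- The orthogonal group of the form `J`; the group of the homogeneous space is a cover of
its identity component, so it is locally the same group. -/
def group (n k : ℕ) : Set (Mat n k) := {g | gᵀ * J n k * g = J n k}

/-- The Lie algebra `𝔤 = so(n+k,k)`: matrices `X` with `Xᵀ J + J X = 0`. -/
abbrev 𝔤 (n k : ℕ) : LieSubalgebra ℝ (Mat n k) := skewAdjointMatricesLieSubalgebra (J n k)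

/-- The parabolic subalgebra `𝔭 ⊆ 𝔤`: the stabilizer of the maximal isotropic subspace spanned by
the first `k` basis vectors. -/
def 𝔭 (n k : ℕ) : LieSubalgebra ℝ (𝔤 n k) where
  carrier := {Z | ∀ r a, (Z : Mat n k) (.inr r) (.inl a) = 0}
  add_mem' := by
    intro X Y hX hY r a
    simp [hX r a, hY r a]
  zero_mem' := by intro r a; simp
  smul_mem' := by
    intro c X hX r a
    simp [hX r a]
  lie_mem' := by
    intro X Y hX hY r a
    have hX' : ∀ r a, (X : Mat n k) (.inr r) (.inl a) = 0 := hX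
    have hY' : ∀ r a, (Y : Mat n k) (.inr r) (.inl a) = 0 := hY
    simp [LieSubalgebra.coe_bracket, Ring.lie_def, Matrix.mul_apply, hX', hY']

/-- The `gl(k,ℝ)`-component of an element of `𝔤`. -/
def glPart {n k : ℕ} (Z : 𝔤 n k) : Matrix (Fin k) (Fin k) ℝ :=
  Matrix.of fun a b => (Z : Mat n k) (.inl a) (.inl b)

/-- The `so(n)`-component of an element of `𝔤`. -/
def soPart {n k : ℕ} (Z : 𝔤 n k) : LieAlgebra.Orthogonal.so (Fin n) ℝ :=
  ⟨Matrix.of fun α β => (Z : Mat n k) (.inr (.inl α)) (.inr (.inl β)), by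
    have h := (mem_skewAdjointMatricesSubmodule (J n k) (Z : Mat n k)).1
      ((mem_skewAdjointMatricesLieSubalgebra (J n k) (Z : Mat n k)).1 Z.2)
    rw [LieAlgebra.Orthogonal.mem_so]
    have h2 : (Z : Mat n k)ᵀ * J n k = J n k * (-(Z : Mat n k)) := h
    ext α β
    have h3 := congrFun (congrFun h2 (.inr (.inl α))) (.inr (.inl β))
    simpa [Matrix.mul_apply, J] using h3⟩

/-! ### The Curved Casimir operator on the homogeneous model -/

/-- The derivative of a function along the left invariant vector field given by `X ∈ 𝔤`
(for `g` in the group, `g X` is the value of this field at `g`). -/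
def leftDeriv {n k : ℕ} (X : 𝔤 n k) (u : Mat n k → ℂ) : Mat n k → ℂ :=
  fun g => fderiv ℝ u g (g * (X : Mat n k))

/-- Gram matrix of the invariant form `t κ` in a basis of `𝔤`, with `κ` the Killing form. -/
def gram (n k : ℕ) (t : ℝ) :
    Matrix (Fin (Module.finrank ℝ (𝔤 n k))) (Fin (Module.finrank ℝ (𝔤 n k))) ℝ :=
  Matrix.of fun a b =>
    t * killingForm ℝ (𝔤 n k) (Module.finBasis ℝ (𝔤 n k) a) (Module.finBasis ℝ (𝔤 n k) b)

/-- The Curved Casimir operator with respect to the form `t κ`, on (components of) functions on the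
group: the second fundamental derivative contracted with the form induced by `t κ` on `𝔤*`. -/
def curvedCasimir {n k : ℕ} (t : ℝ) (u : Mat n k → ℂ) : Mat n k → ℂ :=
  fun g => ∑ a, ∑ b, (((gram n k t)⁻¹ a b : ℝ) : ℂ) *
    leftDeriv (Module.finBasis ℝ (𝔤 n k) a) (leftDeriv (Module.finBasis ℝ (𝔤 n k) b) u) g

/-- A local section, over an open set, of the homogeneous bundle induced by the action `ρ` of `𝔭`
on `W`: a smooth `W`-valued function `f` with `Z.f = -ρ(Z) f` for all `Z ∈ 𝔭`.
Smoothness and derivatives are tested on the components `ℓ ∘ f`, and smooth functions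
on the group are locally given as restrictions of smooth functions of the matrix. -/
structure IsSection {n k : ℕ} {W : Type*} [AddCommGroup W] [Module ℂ W]
    (ρ : 𝔭 n k → Module.End ℂ W) (Ω : Set (Mat n k)) (f : Mat n k → W) : Prop where
  smooth : ∀ l : W →ₗ[ℂ] ℂ, ContDiffOn ℝ ∞ (fun g => l (f g)) Ω
  equivariant : ∀ (l : W →ₗ[ℂ] ℂ) (Z : 𝔭 n k), ∀ g ∈ Ω ∩ group n k,
    leftDeriv (Z : 𝔤 n k) (fun h => l (f h)) g = -l (ρ Z (f g))

/-- The Curved Casimir operator (for the form `t κ`) acts as multiplication by the number `c` on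
the local sections of the homogeneous bundle induced by the `𝔭`-module `W`. -/
def CasimirActsBy {n k : ℕ} {W : Type*} [AddCommGroup W] [Module ℂ W]
    (t : ℝ) (ρ : 𝔭 n k → Module.End ℂ W) (c : ℝ) : Prop :=
  ∀ (Ω : Set (Mat n k)) (f : Mat n k → W), IsOpen Ω → IsSection ρ Ω f →
    ∀ (l : W →ₗ[ℂ] ℂ), ∀ g ∈ Ω ∩ group n k,
      curvedCasimir t (fun h => l (f h)) g = (c : ℂ) * l (f g)

/-! ### Modules -/

/-- The exterior tensor product of a `gl(k,ℝ)`-module and an `so(n)`-module, as a `𝔭`-module on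
which the nilradical `𝔭₊` acts trivially. -/
def leviAction {n k : ℕ} {V S : Type*} [AddCommGroup V] [Module ℂ V] [AddCommGroup S] [Module ℂ S]
    (σ : Matrix (Fin k) (Fin k) ℝ → Module.End ℂ V)
    (τ : LieAlgebra.Orthogonal.so (Fin n) ℝ → Module.End ℂ S) (Z : 𝔭 n k) :
    Module.End ℂ (V ⊗[ℂ] S) :=
  TensorProduct.map (σ (glPart (Z : 𝔤 n k))) LinearMap.id +
    TensorProduct.map LinearMap.id (τ (soPart (Z : 𝔤 n k)))

/-- `V` is the irreducible complex `gl(k,ℝ)`-module with highest weight `lam`. -/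
structure IsIrreducibleOfHighestWeight {k : ℕ} {V : Type*} [AddCommGroup V] [Module ℂ V]
    (σ : Matrix (Fin k) (Fin k) ℝ →ₗ⁅ℝ⁆ Module.End ℂ V) (lam : Fin k → ℝ) : Prop where
  finite : FiniteDimensional ℂ V
  nontrivial : Nontrivial V
  irreducible : ∀ U : Submodule ℂ V, (∀ A, ∀ v ∈ U, σ A v ∈ U) → U = ⊥ ∨ U = ⊤
  highest : ∃ v : V, v ≠ 0 ∧ (∀ a, σ (Matrix.single a a 1) v = ((lam a : ℝ) : ℂ) • v) ∧
    ∀ a b, a < b → σ (Matrix.single a b 1) v = 0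

/-- The quadratic form `-∑ x_α²` on `ℝⁿ`, so that `ε_α ε_β + ε_β ε_α = -2 δ_{αβ}`. -/
abbrev Q (n : ℕ) : QuadraticForm ℝ (Fin n → ℝ) :=
  QuadraticMap.weightedSumSquares ℝ (fun _ : Fin n => (-1 : ℝ))

section Spin

variable {n : ℕ} {S : Type*} [AddCommGroup S] [Module ℂ S]

/-- `S` is an irreducible complex module over the Clifford algebra (for even `n`: the spinor
module, unique up to isomorphism). -/
structure IsSpinorModule (cl : CliffordAlgebra (Q n) →ₐ[ℝ] Module.End ℂ S) : Prop where
  nontrivial : Nontrivial S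
  irreducible : ∀ U : Submodule ℂ S, (∀ x, ∀ v ∈ U, cl x v ∈ U) → U = ⊥ ∨ U = ⊤

/-- Clifford multiplication by the basis vector `ε_α`. -/
def gam (cl : CliffordAlgebra (Q n) →ₐ[ℝ] Module.End ℂ S) (α : Fin n) : Module.End ℂ S :=
  cl (CliffordAlgebra.ι (Q n) (Pi.single α 1))

/-- The action of `so(n)` on spinors, `Y ↦ -(1/4) ∑ Y_{αβ} ε_α ε_β`, i.e. the one with
`[Y, ε_ν] = ∑ Y_{αν} ε_α`. -/
def spinAction (cl : CliffordAlgebra (Q n) →ₐ[ℝ] Module.End ℂ S)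
    (Y : LieAlgebra.Orthogonal.so (Fin n) ℝ) : Module.End ℂ S :=
  ∑ α, ∑ β, (((-(1 / 4) * (Y : Matrix (Fin n) (Fin n) ℝ) α β : ℝ)) : ℂ) • (gam cl α * gam cl β)

/-- The complex volume element `i^{n/2} ε_1 ⋯ ε_n` (its square is `1` for even `n`). -/
def vol (cl : CliffordAlgebra (Q n) →ₐ[ℝ] Module.End ℂ S) : Module.End ℂ S :=
  (Complex.I ^ (n / 2)) • (List.ofFn (gam cl)).prod

/-- The half-spin modules: `𝕊₊` for `s = 1` and `𝕊₋` for `s = -1`. -/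
def halfSpin (cl : CliffordAlgebra (Q n) →ₐ[ℝ] Module.End ℂ S) (s : ℤˣ) : Submodule ℂ S :=
  LinearMap.ker (vol cl - (((s : ℤ) : ℂ)) • (1 : Module.End ℂ S))

/-- The twistor module `𝕋` attached to `𝕊_s`: the kernel of Clifford multiplication
`E ⊗ 𝕊_s → 𝕊_{-s}`; an element `∑ ε_α ⊗ ψ_α` of `E ⊗ 𝕊` is written as the tuple `ψ`. -/
def twistor (cl : CliffordAlgebra (Q n) →ₐ[ℝ] Module.End ℂ S) (s : ℤˣ) :
    Submodule ℂ (Fin n → S) where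
  carrier := {ψ | (∀ α, ψ α ∈ halfSpin cl s) ∧ ∑ α, gam cl α (ψ α) = 0}
  add_mem' := by
    rintro x y ⟨hx, hx'⟩ ⟨hy, hy'⟩
    refine ⟨fun α => Submodule.add_mem _ (hx α) (hy α), ?_⟩
    simp [Finset.sum_add_distrib, hx', hy']
  zero_mem' := ⟨fun α => Submodule.zero_mem _, by simp⟩
  smul_mem' := by
    rintro c x ⟨hx, hx'⟩
    refine ⟨fun α => Submodule.smul_mem _ c (hx α), ?_⟩
    simp [← Finset.smul_sum, hx']

/-- The action of `so(n)` on `E ⊗ 𝕊`. -/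
def vectorSpinAction (cl : CliffordAlgebra (Q n) →ₐ[ℝ] Module.End ℂ S)
    (Y : LieAlgebra.Orthogonal.so (Fin n) ℝ) : Module.End ℂ (Fin n → S) :=
  LinearMap.pi fun α =>
    (∑ β, (((Y : Matrix (Fin n) (Fin n) ℝ) α β : ℝ) : ℂ) •
      (LinearMap.proj β : (Fin n → S) →ₗ[ℂ] S)) +
    spinAction cl Y ∘ₗ LinearMap.proj α

theorem gam_mul_add (cl : CliffordAlgebra (Q n) →ₐ[ℝ] Module.End ℂ S) (α β : Fin n) :
    gam cl α * gam cl β + gam cl β * gam cl α = if α = β then -2 else 0 := by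
  have h := CliffordAlgebra.ι_mul_ι_add_swap (Q := Q n) (Pi.single α 1) (Pi.single β 1)
  have h2 := congrArg cl h
  simp only [map_add, map_mul] at h2
  rw [gam, gam, h2, AlgHomClass.commutes]
  have h3 : QuadraticMap.polar (Q n) (Pi.single α 1) (Pi.single β 1)
      = if α = β then (-2 : ℝ) else 0 := by
    simp only [QuadraticMap.polar, QuadraticMap.weightedSumSquares_apply, ← Finset.sum_sub_distrib]
    rw [Finset.sum_eq_single α]
    · by_cases h : α = β
      · subst h; simp; norm_num
      · simp [h]
    · intro γ _ hγ
      by_cases h : γ = β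
      · subst h; simp [hγ]
      · simp [hγ, h]
    · simp
  rw [h3]
  split_ifs
  · rw [map_neg, map_ofNat]
  · simp

theorem gam_mul_prod (cl : CliffordAlgebra (Q n) →ₐ[ℝ] Module.End ℂ S) (α : Fin n)
    (L : List (Fin n)) :
    gam cl α * (L.map (gam cl)).prod =
      ((-1 : ℂ) ^ (L.length + L.count α)) • ((L.map (gam cl)).prod * gam cl α) := by
  induction L with
  | nil => simp
  | cons β L ih =>
    have hc := gam_mul_add cl α β
    simp only [List.map_cons, List.prod_cons, List.length_cons, ← mul_assoc]
    by_cases h : α = β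
    · subst h
      conv_lhs => rw [mul_assoc, ih, mul_smul_comm, ← mul_assoc]
      rw [List.count_cons_self]
      congr 1
      ring
    · rw [if_neg h] at hc
      rw [eq_neg_of_add_eq_zero_left hc, neg_mul, mul_assoc, ih, List.count_cons_of_ne (Ne.symm h),
        mul_smul_comm, mul_assoc, ← neg_smul]
      congr 1
      ring

theorem gam_mul_vol (cl : CliffordAlgebra (Q n) →ₐ[ℝ] Module.End ℂ S) (α : Fin n) :
    gam cl α * vol cl = ((-1 : ℂ) ^ (n + 1)) • (vol cl * gam cl α) := by
  have h := gam_mul_prod cl α (List.finRange n)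
  rw [List.count_eq_one_of_mem (List.nodup_finRange n) (List.mem_finRange α),
    List.length_finRange, ← List.ofFn_eq_map] at h
  rw [vol, mul_smul_comm, smul_mul_assoc, h, smul_comm]

theorem spinAction_mem (cl : CliffordAlgebra (Q n) →ₐ[ℝ] Module.End ℂ S) (s : ℤˣ)
    (Y : LieAlgebra.Orthogonal.so (Fin n) ℝ) :
    ∀ x ∈ halfSpin cl s, spinAction cl Y x ∈ halfSpin cl s := by
  have hcomm : vol cl * spinAction cl Y = spinAction cl Y * vol cl := by
    simp only [spinAction, Finset.mul_sum, Finset.sum_mul]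
    refine Finset.sum_congr rfl fun α _ => Finset.sum_congr rfl fun β _ => ?_
    rw [mul_smul_comm, smul_mul_assoc]
    congr 1
    rw [mul_assoc, gam_mul_vol, mul_smul_comm, ← mul_assoc, ← mul_assoc, gam_mul_vol,
      smul_mul_assoc, smul_smul, ← mul_pow]
    simp
  intro x hx
  have hx' : vol cl x = ((s : ℤ) : ℂ) • x := by
    simpa [halfSpin, sub_eq_zero] using hx
  have h := LinearMap.congr_fun hcomm x
  simp only [Module.End.mul_apply, hx', map_smul] at h
  simp [halfSpin, h]

theorem spinAction_comm (cl : CliffordAlgebra (Q n) →ₐ[ℝ] Module.End ℂ S)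
    (Y : LieAlgebra.Orthogonal.so (Fin n) ℝ) (ν : Fin n) :
    gam cl ν * spinAction cl Y = spinAction cl Y * gam cl ν -
      ∑ α, (((Y : Matrix (Fin n) (Fin n) ℝ) α ν : ℝ) : ℂ) • gam cl α := by
  have hY : ∀ α β, (Y : Matrix (Fin n) (Fin n) ℝ) β α = -(Y : Matrix (Fin n) (Fin n) ℝ) α β := by
    have h := (LieAlgebra.Orthogonal.mem_so (Fin n) ℝ _).1 Y.2
    intro α β
    simpa using congrFun (congrFun h α) β
  have key : ∀ α β, gam cl ν * (gam cl α * gam cl β) = gam cl α * gam cl β * gam cl ν +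
      ((if α = ν then (-2 : ℂ) else 0) • gam cl β - (if β = ν then (-2 : ℂ) else 0) • gam cl α) := by
    intro α β
    have h1 := eq_sub_of_add_eq (gam_mul_add cl ν α)
    have h2 := eq_sub_of_add_eq (gam_mul_add cl ν β)
    rw [← mul_assoc, h1, sub_mul, mul_assoc, h2, mul_sub, mul_assoc]
    have e1 : (if ν = α then (-2 : Module.End ℂ S) else 0) * gam cl β =
        (if α = ν then (-2 : ℂ) else 0) • gam cl β := by
      by_cases h : α = ν
      · subst h; ext x; simp [two_smul]
      · simp [h, Ne.symm h]
    have e2 : gam cl α * (if ν = β then (-2 : Module.End ℂ S) else 0) =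
        (if β = ν then (-2 : ℂ) else 0) • gam cl α := by
      by_cases h : β = ν
      · subst h; ext x; simp [two_smul]
      · simp [h, Ne.symm h]
    rw [e1, e2]
    abel
  simp only [spinAction, Finset.mul_sum, Finset.sum_mul, mul_smul_comm, smul_mul_assoc, key,
    smul_add, Finset.sum_add_distrib]
  rw [sub_eq_add_neg]
  congr 1
  have aux : ∀ y : Fin n → Fin n → ℝ, (∀ α β, y β α = -y α β) →
      (∑ α, ∑ β, ((-(1 / 4) * y α β : ℝ) : ℂ) •
        ((if α = ν then (-2 : ℂ) else 0) • gam cl β - (if β = ν then (-2 : ℂ) else 0) • gam cl α)) =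
      -∑ α, ((y α ν : ℝ) : ℂ) • gam cl α := by
    intro y hy
    simp only [smul_sub, Finset.sum_sub_distrib, smul_smul, ite_smul, smul_ite,
      zero_smul, smul_zero]
    conv_lhs => enter [1]; rw [Finset.sum_comm]
    simp only [Finset.sum_ite_eq', Finset.mem_univ, if_true]
    rw [← Finset.sum_sub_distrib, ← Finset.sum_neg_distrib]
    refine Finset.sum_congr rfl fun α _ => ?_
    rw [hy α ν, ← sub_smul, ← neg_smul]
    congr 1
    push_cast
    ring
  have hfin := aux (fun α β => (Y : Matrix (Fin n) (Fin n) ℝ) α β) hY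
  simpa only [smul_sub, Finset.sum_sub_distrib] using hfin

theorem vectorSpinAction_mem (cl : CliffordAlgebra (Q n) →ₐ[ℝ] Module.End ℂ S) (s : ℤˣ)
    (Y : LieAlgebra.Orthogonal.so (Fin n) ℝ) :
    ∀ x ∈ twistor cl s, vectorSpinAction cl Y x ∈ twistor cl s := by
  rintro x ⟨hx, hx'⟩
  refine ⟨fun α => ?_, ?_⟩
  · simp only [vectorSpinAction, LinearMap.pi_apply, LinearMap.add_apply, LinearMap.sum_apply,
      LinearMap.smul_apply, LinearMap.proj_apply, LinearMap.comp_apply]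
    exact Submodule.add_mem _
      (Submodule.sum_mem _ fun β _ => Submodule.smul_mem _ _ (hx β)) (spinAction_mem cl s Y _ (hx α))
  · have h : ∀ α, gam cl α (spinAction cl Y (x α)) = spinAction cl Y (gam cl α (x α)) -
        ∑ β, (((Y : Matrix (Fin n) (Fin n) ℝ) β α : ℝ) : ℂ) • gam cl β (x α) := by
      intro α
      simpa using LinearMap.congr_fun (spinAction_comm cl Y α) (x α)
    simp only [vectorSpinAction, LinearMap.pi_apply, LinearMap.add_apply, LinearMap.sum_apply,
      LinearMap.smul_apply, LinearMap.proj_apply, LinearMap.comp_apply, map_add, map_sum, map_smul,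
      h, Finset.sum_add_distrib, Finset.sum_sub_distrib]
    rw [← map_sum, hx', map_zero, Finset.sum_comm]
    abel

/-- The half-spin representations of `so(n)`. -/
def halfSpinAction (cl : CliffordAlgebra (Q n) →ₐ[ℝ] Module.End ℂ S) (s : ℤˣ)
    (Y : LieAlgebra.Orthogonal.so (Fin n) ℝ) : Module.End ℂ (halfSpin cl s) :=
  (spinAction cl Y).restrict (spinAction_mem cl s Y)

/-- The twistor representations of `so(n)`. -/
def twistorAction (cl : CliffordAlgebra (Q n) →ₐ[ℝ] Module.End ℂ S) (s : ℤˣ)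
    (Y : LieAlgebra.Orthogonal.so (Fin n) ℝ) : Module.End ℂ (twistor cl s) :=
  (vectorSpinAction cl Y).restrict (vectorSpinAction_mem cl s Y)

end Spin

/-! ### Weights -/

/-- `lam - ½(n-1,…,n-1)` is a partition (with at most `k` parts) whose Young diagram is symmetric
with respect to the main diagonal. -/
def IsSymmetricWeight (n k : ℕ) (lam : Fin k → ℝ) : Prop :=
  ∃ Y : YoungDiagram, Y.transpose = Y ∧ (∀ a, k ≤ a → Y.rowLen a = 0) ∧
    ∀ a : Fin k, lam a = ((n : ℝ) - 1) / 2 + Y.rowLen a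

end KDirac

end

noncomputable section

namespace KDirac

/-! ### The Casimir tensor of `so(n+k,k)` -/

/-- The involution of the index set under which `J` pairs the basis vectors. -/
def bar {n k : ℕ} : Idx n k → Idx n k
  | .inl a => .inr (.inr a)
  | .inr (.inl α) => .inr (.inl α)
  | .inr (.inr a) => .inl a

@[simp] theorem bar_bar {n k : ℕ} (p : Idx n k) : bar (bar p) = p := by
  rcases p with a | α | a <;> rfl

/-- The involution `bar` as a permutation. -/
def barEquiv (n k : ℕ) : Idx n k ≃ Idx n k := ⟨bar, bar, bar_bar, bar_bar⟩

theorem bar_eq_iff {n k : ℕ} {p q : Idx n k} : bar p = q ↔ p = bar q := by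
  constructor <;> rintro rfl <;> simp

theorem J_apply {n k : ℕ} (p q : Idx n k) : J n k p q = if bar p = q then 1 else 0 := by
  rcases p with a | α | a <;> rcases q with b | β | b <;> simp [J, bar]

theorem J_mul_apply {n k : ℕ} (X : Mat n k) (p q : Idx n k) : (J n k * X) p q = X (bar p) q := by
  simp [Matrix.mul_apply, J_apply]

theorem mul_J_apply {n k : ℕ} (X : Mat n k) (p q : Idx n k) : (X * J n k) p q = X p (bar q) := by
  simp [Matrix.mul_apply, J_apply, bar_eq_iff]

theorem J_mul_J (n k : ℕ) : J n k * J n k = 1 := by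
  ext p q
  rw [J_mul_apply, J_apply, bar_bar, Matrix.one_apply]

theorem mem_𝔤_iff {n k : ℕ} {X : Mat n k} :
    X ∈ 𝔤 n k ↔ ∀ p q, X (bar q) (bar p) = -X p q := by
  rw [mem_skewAdjointMatricesLieSubalgebra, mem_skewAdjointMatricesSubmodule]
  change Xᵀ * J n k = J n k * (-X) ↔ _
  rw [← Matrix.ext_iff]
  simp only [J_mul_apply, mul_J_apply, Matrix.transpose_apply, Matrix.neg_apply]
  constructor
  · intro h p q
    simpa using h (bar p) q
  · intro h p q
    simpa using h (bar p) q

theorem apply_bar {n k : ℕ} (X : 𝔤 n k) (p q : Idx n k) :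
    (X : Mat n k) (bar q) (bar p) = -(X : Mat n k) p q :=
  mem_𝔤_iff.1 X.2 p q

/-- The elements `E_{pq} - E_{bar q, bar p}`, which span `𝔤`. -/
def F {n k : ℕ} (p q : Idx n k) : 𝔤 n k :=
  ⟨Matrix.single p q 1 - Matrix.single (bar q) (bar p) 1, by
    rw [mem_𝔤_iff]
    intro r s
    simp only [Matrix.sub_apply, Matrix.single_apply, bar_eq_iff, bar_bar, neg_sub]
    simp only [and_comm]⟩

theorem F_coe {n k : ℕ} (p q : Idx n k) :
    (F p q : Mat n k) = Matrix.single p q 1 - Matrix.single (bar q) (bar p) 1 := rfl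

theorem coe_sum {n k : ℕ} {ι : Type*} (s : Finset ι) (f : ι → 𝔤 n k) :
    ((∑ x ∈ s, f x : 𝔤 n k) : Mat n k) = ∑ x ∈ s, (f x : Mat n k) :=
  map_sum (𝔤 n k).toSubmodule.subtype f s

theorem coe_smul {n k : ℕ} (c : ℝ) (X : 𝔤 n k) :
    ((c • X : 𝔤 n k) : Mat n k) = c • (X : Mat n k) := rfl

theorem F_bar {n k : ℕ} (p q : Idx n k) : F (bar q) (bar p) = -F p q := by
  ext1
  simp [F_coe]

theorem trace_mul_F {n k : ℕ} (Y : 𝔤 n k) (p q : Idx n k) :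
    ((Y : Mat n k) * (F q p : Mat n k)).trace = 2 * (Y : Mat n k) p q := by
  rw [F_coe, mul_sub, Matrix.trace_sub, Matrix.trace_mul_single, Matrix.trace_mul_single,
    apply_bar]
  simp
  ring

theorem sum_smul_F {n k : ℕ} (Y : 𝔤 n k) :
    ∑ p, ∑ q, (Y : Mat n k) p q • F p q = (2 : ℝ) • Y := by
  ext1
  simp only [coe_sum, coe_smul, F_coe, smul_sub, Finset.sum_sub_distrib, Matrix.smul_single,
    smul_eq_mul, mul_one]
  have h : ∑ p, ∑ q, Matrix.single (bar q) (bar p) ((Y : Mat n k) p q) = -(Y : Mat n k) := by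
    conv_rhs => rw [Matrix.matrix_eq_sum_single (Y : Mat n k)]
    rw [← Equiv.sum_comp (barEquiv n k), Finset.sum_comm, ← Finset.sum_neg_distrib,
      ← Equiv.sum_comp (barEquiv n k)]
    refine Finset.sum_congr rfl fun p _ => ?_
    rw [← Finset.sum_neg_distrib]
    refine Finset.sum_congr rfl fun q _ => ?_
    change Matrix.single (bar (bar p)) (bar (bar q)) ((Y : Mat n k) (bar q) (bar p)) = _
    rw [apply_bar, bar_bar, bar_bar, Matrix.single_neg]
  rw [h, ← Matrix.matrix_eq_sum_single, sub_neg_eq_add, two_smul]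

/-- The adjoint involution `M ↦ J Mᵀ J`. -/
def adjInvolution (n k : ℕ) : Mat n k →ₗ[ℝ] Mat n k where
  toFun M := Matrix.of fun p q => M (bar q) (bar p)
  map_add' _ _ := rfl
  map_smul' _ _ := rfl

theorem adjInvolution_apply {n k : ℕ} (M : Mat n k) (p q : Idx n k) :
    adjInvolution n k M p q = M (bar q) (bar p) := rfl

theorem adjInvolution_single {n k : ℕ} (p q : Idx n k) :
    adjInvolution n k (Matrix.single p q 1) = Matrix.single (bar q) (bar p) 1 := by
  ext r s
  rw [adjInvolution_apply, Matrix.single_apply, Matrix.single_apply]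
  simp only [bar_eq_iff, and_comm]

theorem trace_matrix_end {ι : Type*} [Fintype ι] [DecidableEq ι]
    (f : Matrix ι ι ℝ →ₗ[ℝ] Matrix ι ι ℝ) :
    LinearMap.trace ℝ _ f = ∑ p, ∑ q, f (Matrix.single p q 1) p q := by
  rw [LinearMap.trace_eq_matrix_trace ℝ (Matrix.stdBasis ℝ ι ι), Matrix.trace,
    Fintype.sum_prod_type]
  refine Finset.sum_congr rfl fun p _ => Finset.sum_congr rfl fun q _ => ?_
  rw [Matrix.diag_apply, LinearMap.toMatrix_apply, Matrix.stdBasis_eq_single]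
  rfl

theorem trace_eq_zero {n k : ℕ} (X : 𝔤 n k) : (X : Mat n k).trace = 0 := by
  have h : (X : Mat n k).trace = -(X : Mat n k).trace := by
    conv_lhs => rw [Matrix.trace, ← Equiv.sum_comp (barEquiv n k)]
    simp only [Matrix.trace, Matrix.diag_apply, ← Finset.sum_neg_distrib]
    exact Finset.sum_congr rfl fun p _ => apply_bar X p p
  linarith

theorem single_mul_apply' {ι : Type*} [Fintype ι] [DecidableEq ι] (A B : Matrix ι ι ℝ)
    (p q r s : ι) : (A * Matrix.single p q (1 : ℝ) * B : Matrix ι ι ℝ) r s = A r p * B q s := by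
  rw [Matrix.mul_apply, Finset.sum_eq_single q]
  · simp
  · intro x _ hx
    simp [Matrix.mul_single_apply_of_ne _ _ _ _ _ hx]
  · simp

/-- The Killing form of `so(n+k,k)` is `(n+2k-2)` times the trace form. -/
theorem killingForm_eq {n k : ℕ} (X Y : 𝔤 n k) :
    killingForm ℝ (𝔤 n k) X Y = ((n : ℝ) + 2 * k - 2) * ((X : Mat n k) * (Y : Mat n k)).trace := by
  set x : Mat n k := X.1 with hx_def
  set y : Mat n k := Y.1 with hy_def
  let P : Mat n k →ₗ[ℝ] Mat n k := (1 / 2 : ℝ) • (LinearMap.id - adjInvolution n k)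
  let f : Mat n k →ₗ[ℝ] Mat n k :=
    ((LieAlgebra.ad ℝ (Mat n k) x : Mat n k →ₗ[ℝ] Mat n k) ∘ₗ
      (LieAlgebra.ad ℝ (Mat n k) y : Mat n k →ₗ[ℝ] Mat n k)) ∘ₗ P
  have hP : ∀ M, P M ∈ 𝔤 n k := by
    intro M
    rw [mem_𝔤_iff]
    intro p q
    simp [P, adjInvolution_apply]
    ring
  have hP' : ∀ M : 𝔤 n k, P M = M := by
    intro M
    ext p q
    simp [P, adjInvolution_apply, apply_bar]
    ring
  have hf : ∀ M, f M ∈ (𝔤 n k).toSubmodule := fun M =>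
    (𝔤 n k).lie_mem X.2 ((𝔤 n k).lie_mem Y.2 (hP M))
  have h1 : killingForm ℝ (𝔤 n k) X Y = LinearMap.trace ℝ _ f := by
    rw [killingForm_apply_apply, ← LinearMap.trace_restrict_eq_of_forall_mem _ f hf]
    congr 1
    refine LinearMap.ext fun M => Subtype.ext ?_
    change ⁅x, ⁅y, (M : Mat n k)⁆⁆ = ⁅x, ⁅y, P M⁆⁆
    rw [hP']
  have h2 : ∀ p q : Idx n k, f (Matrix.single p q 1) p q =
      (1 / 2) * (((x * y) p p * (1 : Mat n k) q q - x p p * y q q - y p p * x q q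
          + (1 : Mat n k) p p * (y * x) q q)
        - ((x * y) p (bar q) * (1 : Mat n k) (bar p) q - x p (bar q) * y (bar p) q
          - y p (bar q) * x (bar p) q + (1 : Mat n k) p (bar q) * (y * x) (bar p) q)) := by
    intro p q
    have h3 : f (Matrix.single p q 1) = (1 / 2 : ℝ) •
        ((x * y * Matrix.single p q 1 * 1 - x * Matrix.single p q 1 * y
          - y * Matrix.single p q 1 * x + 1 * Matrix.single p q 1 * (y * x))
        - (x * y * Matrix.single (bar q) (bar p) 1 * 1 - x * Matrix.single (bar q) (bar p) 1 * y
          - y * Matrix.single (bar q) (bar p) 1 * x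
          + 1 * Matrix.single (bar q) (bar p) 1 * (y * x))) := by
      simp only [f, P, LinearMap.comp_apply, LinearMap.smul_apply, LinearMap.sub_apply,
        LinearMap.id_apply, adjInvolution_single, map_smul, LieAlgebra.ad_apply, Ring.lie_def]
      congr 1
      noncomm_ring
    rw [h3]
    simp only [Matrix.smul_apply, Matrix.sub_apply, Matrix.add_apply, single_mul_apply',
      smul_eq_mul]
  have hxb : ∀ p q, x (bar p) q = -x (bar q) p := fun p q => by
    simpa using apply_bar X (bar q) p
  have hyb : ∀ p q, y (bar p) q = -y (bar q) p := fun p q => by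
    simpa using apply_bar Y (bar q) p
  have hb : ∀ g : Idx n k → ℝ, ∑ q, g (bar q) = ∑ q, g q := Equiv.sum_comp (barEquiv n k)
  have hx : ∑ p, x p p = 0 := trace_eq_zero X
  have hy : ∑ p, y p p = 0 := trace_eq_zero Y
  have hxy : ∑ p, (x * y) p p = (x * y).trace := rfl
  have hyx : ∑ p, (y * x) p p = (x * y).trace := Matrix.trace_mul_comm y x
  have s1 : ∑ p, ∑ q, (x * y) p (bar q) * (1 : Mat n k) (bar p) q = (x * y).trace := by
    simp [Matrix.one_apply, Matrix.trace]
  have s2 : ∑ p, ∑ q, (1 : Mat n k) p (bar q) * (y * x) (bar p) q = (x * y).trace := by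
    rw [← hyx, ← hb fun p => (y * x) p p]
    refine Finset.sum_congr rfl fun p _ => ?_
    rw [Finset.sum_eq_single (bar p)]
    · rw [bar_bar, Matrix.one_apply_eq, one_mul]
    · intro q _ hq
      rw [Matrix.one_apply_ne (by rw [Ne, ← bar_eq_iff]; exact Ne.symm hq), zero_mul]
    · simp
  have s3 : ∑ p, ∑ q, x p (bar q) * y (bar p) q = -(x * y).trace := by
    rw [Matrix.trace, ← Finset.sum_neg_distrib]
    refine Finset.sum_congr rfl fun p _ => ?_
    rw [Matrix.diag_apply, Matrix.mul_apply, ← hb, ← Finset.sum_neg_distrib]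
    refine Finset.sum_congr rfl fun q _ => ?_
    rw [hyb, mul_neg, bar_bar]
  have s4 : ∑ p, ∑ q, y p (bar q) * x (bar p) q = -(x * y).trace := by
    rw [Matrix.trace_mul_comm]
    rw [Matrix.trace, ← Finset.sum_neg_distrib]
    refine Finset.sum_congr rfl fun p _ => ?_
    rw [Matrix.diag_apply, Matrix.mul_apply, ← hb, ← Finset.sum_neg_distrib]
    refine Finset.sum_congr rfl fun q _ => ?_
    rw [hxb, mul_neg, bar_bar]
  rw [h1, trace_matrix_end]
  simp only [h2, ← Finset.mul_sum, Finset.sum_sub_distrib, Finset.sum_add_distrib, s1, s2, s3, s4]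
  simp only [← Finset.mul_sum, ← Finset.sum_mul, hx, hy, hxy, hyx, Matrix.one_apply_eq]
  simp
  ring

theorem gram_transpose (n k : ℕ) (t : ℝ) : (gram n k t)ᵀ = gram n k t := by
  ext a b
  simp only [gram, Matrix.transpose_apply, Matrix.of_apply]
  rw [LieModule.traceForm_comm]

/-- Contraction of a bilinear map with the inverse of `t κ`, in terms of dual families. -/
theorem sum_gram_inv {n k : ℕ} {t : ℝ} {ι : Type*} [Fintype ι] (u v : ι → 𝔤 n k)
    (h : ∀ Y, ∑ p, (t * killingForm ℝ (𝔤 n k) Y (v p)) • u p = Y)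
    (φ : 𝔤 n k →ₗ[ℝ] 𝔤 n k →ₗ[ℝ] ℂ) :
    ∑ a, ∑ b, (((gram n k t)⁻¹ a b : ℝ) : ℂ) *
      φ (Module.finBasis ℝ (𝔤 n k) a) (Module.finBasis ℝ (𝔤 n k) b) = ∑ p, φ (u p) (v p) := by
  set b := Module.finBasis ℝ (𝔤 n k)
  let U : Matrix (Fin (Module.finrank ℝ (𝔤 n k))) ι ℝ := Matrix.of fun a p => b.repr (u p) a
  let V : Matrix (Fin (Module.finrank ℝ (𝔤 n k))) ι ℝ := Matrix.of fun a p => b.repr (v p) a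
  have hU : ∀ p, u p = ∑ a, U a p • b a := fun p => (b.sum_repr (u p)).symm
  have hV : ∀ p, v p = ∑ a, V a p • b a := fun p => (b.sum_repr (v p)).symm
  have h1 : U * Vᵀ * gram n k t = 1 := by
    ext a c
    have h2 := congrArg (fun z => b.repr z a) (h (b c))
    have h3 : ∀ p, t * killingForm ℝ (𝔤 n k) (b c) (v p) = (Vᵀ * gram n k t) p c := by
      intro p
      rw [hV, map_sum, Finset.mul_sum, Matrix.mul_apply]
      refine Finset.sum_congr rfl fun d _ => ?_
      rw [← gram_transpose, map_smul, smul_eq_mul]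
      simp only [Matrix.transpose_apply, gram, Matrix.of_apply, b]
      ring
    simp only [h3, map_sum, map_smul, Finsupp.coe_finsetSum, Finset.sum_apply, Finsupp.smul_apply,
      smul_eq_mul, Module.Basis.repr_self] at h2
    rw [Matrix.mul_assoc, Matrix.mul_apply, Matrix.one_apply]
    rw [Finsupp.single_apply] at h2
    simp only [eq_comm (a := c)] at h2
    rw [← h2]
    exact Finset.sum_congr rfl fun p _ => mul_comm _ _
  rw [Matrix.inv_eq_left_inv h1]
  have h4 : ∀ p, φ (u p) (v p) = ∑ a, ∑ c, ((U a p * V c p : ℝ) : ℂ) * φ (b a) (b c) := by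
    intro p
    rw [hU, hV]
    simp only [map_sum, map_smul, LinearMap.sum_apply, LinearMap.smul_apply, Finset.smul_sum,
      Complex.real_smul]
    rw [Finset.sum_comm]
    refine Finset.sum_congr rfl fun a _ => Finset.sum_congr rfl fun c _ => ?_
    push_cast
    ring
  simp only [h4, Matrix.mul_apply, Matrix.transpose_apply, Complex.ofReal_sum, Finset.sum_mul]
  rw [Finset.sum_comm' (t' := Finset.univ) (s' := fun _ => Finset.univ) (by simp)]
  rw [Finset.sum_comm]
  simp only [Finset.sum_comm (s := (Finset.univ : Finset ι))]

theorem sum_gram_inv_eq_sum_F {n k : ℕ} {t : ℝ} (ht : t ≠ 0) (hN : (n : ℝ) + 2 * k - 2 ≠ 0)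
    (φ : 𝔤 n k →ₗ[ℝ] 𝔤 n k →ₗ[ℝ] ℂ) :
    ∑ a, ∑ b, (((gram n k t)⁻¹ a b : ℝ) : ℂ) *
      φ (Module.finBasis ℝ (𝔤 n k) a) (Module.finBasis ℝ (𝔤 n k) b) =
    ((1 / (4 * t * ((n : ℝ) + 2 * k - 2)) : ℝ) : ℂ) * ∑ p, ∑ q, φ (F p q) (F q p) := by
  set c : ℝ := 1 / (4 * t * ((n : ℝ) + 2 * k - 2)) with hc
  rw [sum_gram_inv (fun x : Idx n k × Idx n k => F x.1 x.2) (fun x => c • F x.2 x.1)]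
  · rw [Fintype.sum_prod_type]
    simp only [map_smul, Complex.real_smul, Finset.mul_sum]
  · intro Y
    rw [Fintype.sum_prod_type]
    have h : ∀ p q, t * killingForm ℝ (𝔤 n k) Y (c • F q p) = (1 / 2) * (Y : Mat n k) p q := by
      intro p q
      rw [map_smul, killingForm_eq, trace_mul_F, smul_eq_mul, hc]
      field_simp
      ring
    simp only [h, mul_smul, ← Finset.smul_sum, sum_smul_F]
    rw [smul_smul]
    norm_num

end KDirac

end

noncomputable section

namespace KDirac

/-! ### Left invariant vector fields -/

section LeftDeriv

variable {n k : ℕ}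

/-- Right multiplication by a fixed matrix, as a continuous linear map. -/
def mulRightCLM (X : Mat n k) : Mat n k →L[ℝ] Mat n k :=
  LinearMap.toContinuousLinearMap (LinearMap.mulRight ℝ X)

theorem contDiffAt_leftDeriv {u : Mat n k → ℂ} {g : Mat n k} (hu : ContDiffAt ℝ ∞ u g)
    (X : 𝔤 n k) : ContDiffAt ℝ ∞ (leftDeriv X u) g :=
  (hu.fderiv_right (m := ∞) le_rfl).clm_apply (mulRightCLM (X : Mat n k)).contDiff.contDiffAt

theorem fderiv_fderiv_apply {E : Type*} [NormedAddCommGroup E] [NormedSpace ℝ E] {u : E → ℂ}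
    {g : E} (hu : ContDiffAt ℝ ∞ u g) (A B : E →L[ℝ] E) :
    fderiv ℝ (fun h => fderiv ℝ u h (B h)) g (A g) =
      fderiv ℝ (fderiv ℝ u) g (A g) (B g) + fderiv ℝ u g (B (A g)) := by
  have h1 : HasFDerivAt (fderiv ℝ u) (fderiv ℝ (fderiv ℝ u) g) g :=
    ((hu.fderiv_right (m := ∞) le_rfl).differentiableAt (by simp)).hasFDerivAt
  rw [(h1.clm_apply B.hasFDerivAt).fderiv]
  simp [add_comm]

/-- First and second derivatives along left invariant fields in terms of the derivative and the
Hessian in matrix coordinates. -/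
theorem exists_leftDeriv_eq {u : Mat n k → ℂ} {g : Mat n k} (hu : ContDiffAt ℝ ∞ u g) :
    ∃ (D : Mat n k →ₗ[ℝ] ℂ) (H : Mat n k →ₗ[ℝ] Mat n k →ₗ[ℝ] ℂ), (∀ x y, H x y = H y x) ∧
      (∀ X : 𝔤 n k, leftDeriv X u g = D (g * X.1)) ∧
      ∀ X Y : 𝔤 n k, leftDeriv X (leftDeriv Y u) g = H (g * X.1) (g * Y.1) + D (g * X.1 * Y.1) := by
  have hs : IsSymmSndFDerivAt ℝ u g := hu.isSymmSndFDerivAt (by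
    rw [minSmoothness_of_isRCLikeNormedField]
    exact WithTop.coe_le_coe.2 le_top)
  exact ⟨(fderiv ℝ u g).toLinearMap,
    ContinuousLinearMap.coeLM ℝ ∘ₗ (fderiv ℝ (fderiv ℝ u) g).toLinearMap,
    fun x y => hs.eq x y, fun X => rfl,
    fun X Y => fderiv_fderiv_apply hu (mulRightCLM X.1) (mulRightCLM Y.1)⟩

/-- Left invariant vector fields form a copy of the Lie algebra. -/
theorem leftDeriv_comm {u : Mat n k → ℂ} {g : Mat n k} (hu : ContDiffAt ℝ ∞ u g) (X Y : 𝔤 n k) :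
    leftDeriv X (leftDeriv Y u) g = leftDeriv Y (leftDeriv X u) g + leftDeriv ⁅X, Y⁆ u g := by
  obtain ⟨D, H, hs, h1, h2⟩ := exists_leftDeriv_eq hu
  rw [h2, h2, h1, hs, LieSubalgebra.coe_bracket, Ring.lie_def, mul_sub, map_sub,
    Matrix.mul_assoc, Matrix.mul_assoc]
  ring

/-- The second derivatives along left invariant fields form a bilinear map. -/
theorem exists_leftDeriv₂ {u : Mat n k → ℂ} {g : Mat n k} (hu : ContDiffAt ℝ ∞ u g) :
    ∃ φ : 𝔤 n k →ₗ[ℝ] 𝔤 n k →ₗ[ℝ] ℂ, ∀ X Y, φ X Y = leftDeriv X (leftDeriv Y u) g := by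
  obtain ⟨D, H, -, -, h2⟩ := exists_leftDeriv_eq hu
  exact ⟨LinearMap.mk₂ ℝ (fun X Y => H (g * X.1) (g * Y.1) + D (g * X.1 * Y.1))
    (by intro X X' Y; simp [mul_add, add_mul]; ring)
    (by intro c X Y; simp)
    (by intro X Y Y'; simp [mul_add]; ring)
    (by intro c X Y; simp), fun X Y => (h2 X Y).symm⟩

theorem exp_mem_group (X : 𝔤 n k) : NormedSpace.exp (X : Mat n k) ∈ group n k := by
  have hJ : IsUnit (J n k) := IsUnit.of_mul_eq_one _ (J_mul_J n k)
  have hJi : (J n k)⁻¹ = J n k := Matrix.inv_eq_left_inv (J_mul_J n k)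
  have hX : (X : Mat n k)ᵀ = J n k * -(X : Mat n k) * (J n k)⁻¹ := by
    rw [hJi]
    ext p q
    rw [mul_J_apply, J_mul_apply, Matrix.neg_apply, apply_bar, neg_neg, Matrix.transpose_apply]
  change (NormedSpace.exp (X : Mat n k))ᵀ * J n k * NormedSpace.exp (X : Mat n k) = J n k
  have h1 : (NormedSpace.exp (X : Mat n k))ᵀ =
      J n k * (NormedSpace.exp (X : Mat n k))⁻¹ * (J n k)⁻¹ := by
    rw [← Matrix.exp_neg, ← Matrix.exp_conj _ _ hJ, ← hX, Matrix.exp_transpose]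
  have h2 := Matrix.nonsing_inv_mul _
    ((Matrix.isUnit_iff_isUnit_det _).1 (Matrix.isUnit_exp (X : Mat n k)))
  rw [h1, hJi, Matrix.mul_assoc _ (J n k) (J n k), J_mul_J, Matrix.mul_one, Matrix.mul_assoc, h2,
    Matrix.mul_one]

theorem mul_mem_group {g h : Mat n k} (hg : g ∈ group n k) (hh : h ∈ group n k) :
    g * h ∈ group n k := by
  change (g * h)ᵀ * J n k * (g * h) = J n k
  have hg' : gᵀ * J n k * g = J n k := hg
  have hh' : hᵀ * J n k * h = J n k := hh
  calc (g * h)ᵀ * J n k * (g * h) = hᵀ * (gᵀ * J n k * g) * h := by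
        rw [Matrix.transpose_mul]; noncomm_ring
    _ = J n k := by rw [hg', hh']

theorem hasDerivAt_linearMap_exp {A : Type*} [NormedRing A] [NormedAlgebra ℝ A]
    [FiniteDimensional ℝ A] (l : A →ₗ[ℝ] ℝ) (x : A) :
    HasDerivAt (fun s : ℝ => l (NormedSpace.exp (s • x))) (l x) 0 := by
  have : CompleteSpace A := FiniteDimensional.complete ℝ A
  have h := (LinearMap.toContinuousLinearMap l).hasFDerivAt.comp_hasDerivAt (0 : ℝ)
    (hasDerivAt_exp_smul_const (𝕂 := ℝ) x 0)
  exact HasDerivAt.congr_deriv h (by simp)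

theorem hasDerivAt_exp_curve (g X : Mat n k) :
    HasDerivAt (fun s : ℝ => g * NormedSpace.exp (s • X)) (g * X) 0 := by
  have h : ∀ p q, HasDerivAt (fun s : ℝ => (NormedSpace.exp (s • X)) p q) (X p q) 0 := by
    intro p q
    let _ := Matrix.linftyOpNormedRing (n := Idx n k) (α := ℝ)
    let _ := Matrix.linftyOpNormedAlgebra (n := Idx n k) (R := ℝ) (α := ℝ)
    exact hasDerivAt_linearMap_exp (Matrix.entryLinearMap ℝ ℝ p q) X
  have h0 : HasDerivAt (fun s : ℝ => NormedSpace.exp (s • X)) X 0 :=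
    hasDerivAt_pi.2 fun p => hasDerivAt_pi.2 fun q => h p q
  exact (LinearMap.toContinuousLinearMap
    (LinearMap.mulLeft ℝ g)).hasFDerivAt.comp_hasDerivAt (0 : ℝ) h0

/-- The derivative at a point of the group along a left invariant field only depends on the
values on the group. -/
theorem leftDeriv_congr {Ω : Set (Mat n k)} (hΩ : IsOpen Ω) {u w : Mat n k → ℂ} {g : Mat n k}
    (hg : g ∈ Ω ∩ group n k) (hu : DifferentiableAt ℝ u g) (hw : DifferentiableAt ℝ w g)
    (h : ∀ x ∈ Ω ∩ group n k, u x = w x) (X : 𝔤 n k) : leftDeriv X u g = leftDeriv X w g := by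
  have hc := hasDerivAt_exp_curve g (X : Mat n k)
  have h0 : g * NormedSpace.exp ((0 : ℝ) • (X : Mat n k)) = g := by simp
  have hu' := HasFDerivAt.comp_hasDerivAt (f := fun s : ℝ => g * NormedSpace.exp (s • X.1)) (0 : ℝ)
    (l := u) (l' := fderiv ℝ u g) (by rw [h0]; exact hu.hasFDerivAt) hc
  have hw' := HasFDerivAt.comp_hasDerivAt (f := fun s : ℝ => g * NormedSpace.exp (s • X.1)) (0 : ℝ)
    (l := w) (l' := fderiv ℝ w g) (by rw [h0]; exact hw.hasFDerivAt) hc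
  refine hu'.unique (hw'.congr_of_eventuallyEq ?_)
  have hΩ' : ∀ᶠ s : ℝ in nhds 0, g * NormedSpace.exp (s • X.1) ∈ Ω :=
    hc.continuousAt.eventually_mem (by rw [h0]; exact hΩ.mem_nhds hg.1)
  filter_upwards [hΩ'] with s hs
  exact h _ ⟨hs, mul_mem_group hg.2 (exp_mem_group (s • X))⟩

end LeftDeriv

end KDirac

end

noncomputable section

namespace KDirac

/-! ### The Casimir operator on sections of bundles induced by Levi modules -/

section Levi

variable {n k : ℕ}

theorem F_apply (p q r s : Idx n k) : (F p q : Mat n k) r s =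
    (if p = r ∧ q = s then 1 else 0) - (if bar q = r ∧ bar p = s then 1 else 0) := by
  rw [F_coe, Matrix.sub_apply, Matrix.single_apply, Matrix.single_apply]

theorem glPart_F_gl (a b : Fin k) :
    glPart (F (n := n) (.inl a) (.inl b)) = Matrix.single a b 1 := by
  ext c d
  simp [glPart, F_apply, bar, Matrix.single_apply]

theorem soPart_F_gl (a b : Fin k) : soPart (F (n := n) (.inl a) (.inl b)) = 0 := by
  ext c d
  simp [soPart, F_apply, bar]

theorem glPart_F_so (α β : Fin n) :
    glPart (F (k := k) (.inr (.inl α)) (.inr (.inl β))) = 0 := by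
  ext c d
  simp [glPart, F_apply, bar]

/-- The elements `E_{αβ} - E_{βα}` of `so(n)`. -/
def soF (α β : Fin n) : LieAlgebra.Orthogonal.so (Fin n) ℝ :=
  ⟨Matrix.single α β 1 - Matrix.single β α 1, by
    rw [LieAlgebra.Orthogonal.mem_so]
    simp⟩

theorem soF_coe (α β : Fin n) : (soF α β : Matrix (Fin n) (Fin n) ℝ) =
    Matrix.single α β 1 - Matrix.single β α 1 := rfl

theorem soPart_F_so (α β : Fin n) :
    soPart (F (k := k) (.inr (.inl α)) (.inr (.inl β))) = soF α β := by
  ext c d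
  simp [soPart, soF, F_apply, bar, Matrix.single_apply]

theorem glPart_F_vec (a : Fin k) (α : Fin n) :
    glPart (F (.inl a) (.inr (.inl α))) = 0 := by
  ext c d
  simp [glPart, F_apply, bar]

theorem soPart_F_vec (a : Fin k) (α : Fin n) :
    soPart (F (.inl a) (.inr (.inl α))) = 0 := by
  ext c d
  simp [soPart, F_apply, bar]

theorem glPart_F_alt (a b : Fin k) :
    glPart (F (n := n) (.inl a) (.inr (.inr b))) = 0 := by
  ext c d
  simp [glPart, F_apply, bar]

theorem soPart_F_alt (a b : Fin k) :
    soPart (F (n := n) (.inl a) (.inr (.inr b))) = 0 := by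
  ext c d
  simp [soPart, F_apply, bar]

theorem F_inl_mem (a : Fin k) (q : Idx n k) : F (.inl a) q ∈ 𝔭 n k := by
  intro r c
  simp [F_apply, bar]

theorem F_so_mem (α β : Fin n) : F (k := k) (.inr (.inl α)) (.inr (.inl β)) ∈ 𝔭 n k := by
  intro r c
  simp [F_apply, bar]

theorem F_inr_inl_inr_inr (α : Fin n) (a : Fin k) :
    F (.inr (.inl α)) (.inr (.inr a)) = -F (.inl a) (.inr (.inl α)) :=
  F_bar (.inl a) (.inr (.inl α))

theorem F_inr_inr_inr_inl (α : Fin n) (a : Fin k) :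
    F (.inr (.inr a)) (.inr (.inl α)) = -F (.inr (.inl α)) (.inl a) :=
  F_bar (.inr (.inl α)) (.inl a)

theorem F_inr_inr_inr_inr (a b : Fin k) :
    F (n := n) (.inr (.inr a)) (.inr (.inr b)) = -F (.inl b) (.inl a) :=
  F_bar (.inl b) (.inl a)

theorem lie_F_vec (a : Fin k) (α : Fin n) :
    ⁅F (.inl a) (.inr (.inl α)), F (.inr (.inl α)) (.inl a)⁆ = F (.inl a) (.inl a) := by
  ext1
  simp [LieSubalgebra.coe_bracket, Ring.lie_def, F_coe, mul_sub, sub_mul, bar]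
  abel

theorem lie_F_alt (a b : Fin k) :
    ⁅F (n := n) (.inl a) (.inr (.inr b)), F (.inr (.inr b)) (.inl a)⁆ =
      if a = b then 0 else F (n := n) (.inl a) (.inl a) + F (n := n) (.inl b) (.inl b) := by
  split_ifs with h
  · subst h
    ext1
    simp [LieSubalgebra.coe_bracket, F_coe, bar]
  · ext1
    have h' := Ne.symm h
    simp [LieSubalgebra.coe_bracket, Ring.lie_def, F_coe, mul_sub, sub_mul, bar, h, h']
    abel

variable {W : Type*} [AddCommGroup W] [Module ℂ W]

theorem IsSection.contDiffAt {ρ : 𝔭 n k → Module.End ℂ W} {Ω : Set (Mat n k)} {f : Mat n k → W}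
    (hf : IsSection ρ Ω f) (hΩ : IsOpen Ω) (l : W →ₗ[ℂ] ℂ) {g : Mat n k} (hg : g ∈ Ω) :
    ContDiffAt ℝ ∞ (fun h => l (f h)) g :=
  (hf.smooth l).contDiffAt (hΩ.mem_nhds hg)

theorem IsSection.leftDeriv_leftDeriv {ρ : 𝔭 n k → Module.End ℂ W} {Ω : Set (Mat n k)}
    {f : Mat n k → W} (hf : IsSection ρ Ω f) (hΩ : IsOpen Ω) (l : W →ₗ[ℂ] ℂ) {g : Mat n k}
    (hg : g ∈ Ω ∩ group n k) (X : 𝔤 n k) (Z : 𝔭 n k) :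
    leftDeriv X (leftDeriv (Z : 𝔤 n k) (fun h => l (f h))) g =
      -leftDeriv X (fun h => (l ∘ₗ ρ Z) (f h)) g := by
  have h1 : ∀ l' : W →ₗ[ℂ] ℂ, DifferentiableAt ℝ (fun h => l' (f h)) g := fun l' =>
    (hf.contDiffAt hΩ l' hg.1).differentiableAt (by simp)
  rw [leftDeriv_congr hΩ hg (w := fun h => (-(l ∘ₗ ρ Z)) (f h))
    ((contDiffAt_leftDeriv (hf.contDiffAt hΩ l hg.1) _).differentiableAt (by simp)) (h1 _)
    (fun x hx => hf.equivariant l Z x hx)]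
  exact DFunLike.congr_fun (fderiv_neg (f := fun h => (l ∘ₗ ρ Z) (f h))) (g * (X : Mat n k))

variable {V S : Type*} [AddCommGroup V] [Module ℂ V] [AddCommGroup S] [Module ℂ S]

/-- The action of `𝔤₀` on the exterior tensor product, as a function on `𝔤`. -/
def leviMap (σ : Matrix (Fin k) (Fin k) ℝ → Module.End ℂ V)
    (τ : LieAlgebra.Orthogonal.so (Fin n) ℝ → Module.End ℂ S) (X : 𝔤 n k) :
    Module.End ℂ (V ⊗[ℂ] S) :=
  TensorProduct.map (σ (glPart X)) LinearMap.id + TensorProduct.map LinearMap.id (τ (soPart X))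

/-- The Casimir operator acts by a scalar if the Casimir elements and the centre of the Levi
factor do. -/
theorem casimirActsBy_leviAction {t : ℝ} (ht : t ≠ 0) (hN : (n : ℝ) + 2 * k - 2 ≠ 0)
    (σ : Matrix (Fin k) (Fin k) ℝ →ₗ⁅ℝ⁆ Module.End ℂ V)
    (τ : LieAlgebra.Orthogonal.so (Fin n) ℝ → Module.End ℂ S) (hτ : τ 0 = 0) {K E s : ℝ}
    (hK : ∑ a, ∑ b, σ (Matrix.single b a 1) * σ (Matrix.single a b 1) = (K : ℂ) • 1)
    (hE : ∑ a, σ (Matrix.single a a 1) = (E : ℂ) • 1)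
    (hs : ∑ α, ∑ β, τ (soF β α) * τ (soF α β) = (s : ℂ) • 1) :
    CasimirActsBy t (leviAction (n := n) σ τ)
      (1 / (4 * t * ((n : ℝ) + 2 * k - 2)) * (2 * K + s - (2 * n + 2 * k - 2) * E)) := by
  intro Ω f hΩ hf l g hg
  have hu : ∀ l' : V ⊗[ℂ] S →ₗ[ℂ] ℂ, ContDiffAt ℝ ∞ (fun h => l' (f h)) g := fun l' =>
    hf.contDiffAt hΩ l' hg.1
  obtain ⟨φ, hφ⟩ := exists_leftDeriv₂ (hu l)
  obtain ⟨D, -, -, hD, -⟩ := exists_leftDeriv_eq (hu l)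
  set R := leviMap (n := n) σ τ with hR
  set w := f g
  have h𝔭 : ∀ l' : V ⊗[ℂ] S →ₗ[ℂ] ℂ, ∀ Z ∈ 𝔭 n k,
      leftDeriv Z (fun h => l' (f h)) g = -l' (R Z w) := fun l' Z hZ =>
    hf.equivariant l' ⟨Z, hZ⟩ g hg
  have hφ𝔭 : ∀ X, X ∈ 𝔭 n k → ∀ Z ∈ 𝔭 n k, φ X Z = l (R Z (R X w)) := by
    intro X hX Z hZ
    rw [hφ, hf.leftDeriv_leftDeriv hΩ l hg X ⟨Z, hZ⟩, h𝔭 _ X hX, neg_neg]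
    rfl
  have hφ0 : ∀ X, ∀ Z ∈ 𝔭 n k, R Z = 0 → φ X Z = 0 := by
    intro X Z hZ hZ0
    rw [hφ, hf.leftDeriv_leftDeriv hΩ l hg X ⟨Z, hZ⟩]
    have h0 : leviAction (n := n) σ τ ⟨Z, hZ⟩ = 0 := hZ0
    simp [h0, leftDeriv]
  have hφlie : ∀ X, ∀ Z ∈ 𝔭 n k, R Z = 0 →
      φ Z X = leftDeriv ⁅Z, X⁆ (fun h => l (f h)) g := by
    intro X Z hZ hZ0
    rw [hφ, leftDeriv_comm (hu l), ← hφ, hφ0 X Z hZ hZ0, zero_add]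
  have hR_gl : ∀ a b, R (F (.inl a) (.inl b)) =
      TensorProduct.map (σ (Matrix.single a b 1)) LinearMap.id := by
    intro a b
    rw [hR, leviMap, glPart_F_gl, soPart_F_gl, hτ, TensorProduct.map_zero_right, add_zero]
  have hR_so : ∀ α β, R (F (.inr (.inl α)) (.inr (.inl β))) =
      TensorProduct.map LinearMap.id (τ (soF α β)) := by
    intro α β
    rw [hR, leviMap, glPart_F_so, soPart_F_so, map_zero, TensorProduct.map_zero_left, zero_add]
  have hR_vec : ∀ a α, R (F (.inl a) (.inr (.inl α))) = 0 := by
    intro a α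
    rw [hR, leviMap, glPart_F_vec, soPart_F_vec, hτ, map_zero, TensorProduct.map_zero_left,
      TensorProduct.map_zero_right, zero_add]
  have hR_alt : ∀ a b, R (F (.inl a) (.inr (.inr b))) = 0 := by
    intro a b
    rw [hR, leviMap, glPart_F_alt, soPart_F_alt, hτ, map_zero, TensorProduct.map_zero_left,
      TensorProduct.map_zero_right, zero_add]
  set B : Fin k → ℂ := fun a => l (R (F (.inl a) (.inl a)) w) with hB
  have hBsum : ∑ a, B a = E * l w := by
    simp only [hB, hR_gl, ← map_sum, ← LinearMap.sum_apply]
    have : ∑ a, TensorProduct.map (σ (Matrix.single a a 1)) (LinearMap.id : S →ₗ[ℂ] S) =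
        (E : ℂ) • LinearMap.id := by
      simp only [← TensorProduct.mapBilinear_apply, ← LinearMap.sum_apply, ← map_sum, hE]
      rw [map_smul, LinearMap.smul_apply, TensorProduct.mapBilinear_apply]
      congr 1
      exact TensorProduct.map_id
    rw [this]
    simp
  have hKsum : ∑ a, ∑ b, φ (F (.inl a) (.inl b)) (F (.inl b) (.inl a)) = K * l w := by
    have h1 : ∀ a b, φ (F (.inl a) (.inl b)) (F (.inl b) (.inl a)) =
        l (TensorProduct.map (σ (Matrix.single b a 1) * σ (Matrix.single a b 1))
          (LinearMap.id : S →ₗ[ℂ] S) w) := by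
      intro a b
      rw [hφ𝔭 _ (F_inl_mem _ _) _ (F_inl_mem _ _), hR_gl, hR_gl,
        ← LinearMap.comp_apply (f := TensorProduct.map _ _),
        ← TensorProduct.map_comp]
      rfl
    simp only [h1, ← map_sum, ← LinearMap.sum_apply]
    have : ∑ a, ∑ b, TensorProduct.map (σ (Matrix.single b a 1) * σ (Matrix.single a b 1))
        (LinearMap.id : S →ₗ[ℂ] S) = (K : ℂ) • LinearMap.id := by
      simp only [← TensorProduct.mapBilinear_apply, ← LinearMap.sum_apply, ← map_sum, hK]
      rw [map_smul, LinearMap.smul_apply, TensorProduct.mapBilinear_apply]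
      congr 1
      exact TensorProduct.map_id
    rw [this]
    simp
  have hssum : ∑ α, ∑ β, φ (F (.inr (.inl α)) (.inr (.inl β))) (F (.inr (.inl β)) (.inr (.inl α))) =
      s * l w := by
    have h1 : ∀ α β, φ (F (.inr (.inl α)) (.inr (.inl β))) (F (.inr (.inl β)) (.inr (.inl α))) =
        l (TensorProduct.map (LinearMap.id : V →ₗ[ℂ] V) (τ (soF β α) * τ (soF α β)) w) := by
      intro a b
      rw [hφ𝔭 _ (F_so_mem _ _) _ (F_so_mem _ _), hR_so, hR_so,
        ← LinearMap.comp_apply (f := TensorProduct.map _ _),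
        ← TensorProduct.map_comp]
      rfl
    simp only [h1, ← map_sum, ← LinearMap.sum_apply]
    have : ∑ α, ∑ β, TensorProduct.map (LinearMap.id : V →ₗ[ℂ] V) (τ (soF β α) * τ (soF α β)) =
        (s : ℂ) • LinearMap.id := by
      simp only [← TensorProduct.mapBilinear_apply, ← map_sum, hs]
      rw [map_smul, TensorProduct.mapBilinear_apply]
      congr 1
      exact TensorProduct.map_id
    rw [this]
    simp
  have hvec : ∀ a α, φ (F (.inl a) (.inr (.inl α))) (F (.inr (.inl α)) (.inl a)) = -B a := by
    intro a α
    rw [hφlie _ _ (F_inl_mem _ _) (hR_vec _ _), lie_F_vec, h𝔭 _ _ (F_inl_mem _ _)]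
  have hvec' : ∀ a α, φ (F (.inr (.inl α)) (.inl a)) (F (.inl a) (.inr (.inl α))) = 0 :=
    fun a α => hφ0 _ _ (F_inl_mem _ _) (hR_vec _ _)
  have halt : ∀ a b, φ (F (.inl a) (.inr (.inr b))) (F (.inr (.inr b)) (.inl a)) =
      if a = b then 0 else -(B a + B b) := by
    intro a b
    rw [hφlie _ _ (F_inl_mem _ _) (hR_alt _ _), lie_F_alt]
    split_ifs
    · simp [leftDeriv]
    · have h1 := h𝔭 l _ (F_inl_mem (n := n) a (.inl a))
      have h2 := h𝔭 l _ (F_inl_mem (n := n) b (.inl b))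
      rw [hD] at h1 h2 ⊢
      rw [AddMemClass.coe_add, mul_add, map_add, h1, h2, neg_add]
  have halt' : ∀ a b, φ (F (.inr (.inr b)) (.inl a)) (F (.inl a) (.inr (.inr b))) = 0 :=
    fun a b => hφ0 _ _ (F_inl_mem _ _) (hR_alt _ _)
  have haltsum : ∑ a, ∑ b, (if a = b then 0 else -(B a + B b)) =
      -((2 * k - 2) * (E * l w)) := by
    have h1 : ∀ a b, (if a = b then 0 else -(B a + B b)) =
        (if a = b then 2 * B a else 0) - B a - B b := by
      intro a b
      split_ifs with h
      · subst h; ring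
      · ring
    simp only [h1, Finset.sum_sub_distrib, Finset.sum_ite_eq, Finset.mem_univ, if_true,
      Finset.sum_const, Finset.card_univ, Fintype.card_fin, nsmul_eq_mul, ← Finset.mul_sum, hBsum]
    ring
  have htotal : ∑ p, ∑ q, φ (F p q) (F q p) =
      (2 * K + s - (2 * n + 2 * k - 2) * E) * l w := by
    simp only [Fintype.sum_sum_type, F_inr_inl_inr_inr, F_inr_inr_inr_inl, F_inr_inr_inr_inr,
      map_neg, LinearMap.neg_apply, neg_neg, hvec, hvec', halt, halt', Finset.sum_add_distrib,
      haltsum, hKsum, hssum, Finset.sum_const, Finset.card_univ, Fintype.card_fin, smul_zero,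
      Finset.sum_neg_distrib, smul_neg, nsmul_eq_mul, ← Finset.mul_sum, hBsum]
    rw [Finset.sum_comm (f := fun a b => φ (F (.inl b) (.inl a)) (F (.inl a) (.inl b))), hKsum]
    ring
  have hfinal := sum_gram_inv_eq_sum_F ht hN φ
  simp only [hφ] at hfinal
  change ∑ a, ∑ b, _ = _
  refine hfinal.trans ?_
  simp only [← hφ]
  rw [htotal]
  push_cast
  ring

end Levi

end KDirac

end

noncomputable section

namespace KDirac

/-! ### The Casimir element of `gl(k)` -/

section GeneralLinear

variable {k : ℕ} {V : Type*} [AddCommGroup V] [Module ℂ V]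

theorem map_single_mul_comm (σ : Matrix (Fin k) (Fin k) ℝ →ₗ⁅ℝ⁆ Module.End ℂ V)
    (a b c d : Fin k) :
    σ (Matrix.single c d 1) * σ (Matrix.single a b 1) =
      σ (Matrix.single a b 1) * σ (Matrix.single c d 1) +
        ((if d = a then σ (Matrix.single c b 1) else 0) -
          if b = c then σ (Matrix.single a d 1) else 0) := by
  have h := σ.map_lie (Matrix.single c d 1) (Matrix.single a b 1)
  rw [Ring.lie_def, Ring.lie_def, map_sub, eq_comm, sub_eq_iff_eq_add'] at h
  rw [h]
  congr 2
  · split_ifs with hd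
    · subst hd
      simp
    · simp [hd]
  · split_ifs with hd
    · subst hd
      simp
    · simp [hd]

theorem commute_of_commute_single (σ : Matrix (Fin k) (Fin k) ℝ →ₗ⁅ℝ⁆ Module.End ℂ V)
    {T : Module.End ℂ V} (h : ∀ a b, Commute T (σ (Matrix.single a b 1)))
    (A : Matrix (Fin k) (Fin k) ℝ) : Commute T (σ A) := by
  rw [Matrix.matrix_eq_sum_single A]
  simp only [map_sum]
  refine Commute.sum_right _ _ _ fun a _ => Commute.sum_right _ _ _ fun b _ => ?_
  rw [← mul_one (A a b), ← smul_eq_mul, ← Matrix.smul_single, map_smul]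
  exact (h a b).smul_right _

theorem commute_casimir (σ : Matrix (Fin k) (Fin k) ℝ →ₗ⁅ℝ⁆ Module.End ℂ V) (c d : Fin k) :
    Commute (∑ a, ∑ b, σ (Matrix.single b a 1) * σ (Matrix.single a b 1))
      (σ (Matrix.single c d 1)) := by
  have h : ∀ a b, σ (Matrix.single c d 1) * (σ (Matrix.single b a 1) * σ (Matrix.single a b 1)) =
      σ (Matrix.single b a 1) * σ (Matrix.single a b 1) * σ (Matrix.single c d 1) +
      (((if d = b then σ (Matrix.single c a 1) * σ (Matrix.single a b 1) else 0) -
          if a = c then σ (Matrix.single b d 1) * σ (Matrix.single a b 1) else 0) +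
        ((if d = a then σ (Matrix.single b a 1) * σ (Matrix.single c b 1) else 0) -
          if b = c then σ (Matrix.single b a 1) * σ (Matrix.single a d 1) else 0)) := by
    intro a b
    rw [← mul_assoc, map_single_mul_comm, add_mul, mul_assoc, map_single_mul_comm σ a b c d,
      mul_add, ← mul_assoc, mul_sub, sub_mul]
    simp only [mul_ite, ite_mul, mul_zero, zero_mul]
    abel
  rw [Commute, SemiconjBy, Finset.mul_sum]
  simp only [Finset.mul_sum, h, Finset.sum_mul, Finset.sum_add_distrib, Finset.sum_sub_distrib]
  rw [Finset.sum_comm (f := fun a b => if a = c then σ (Matrix.single b d 1) *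
      σ (Matrix.single a b 1) else 0),
    Finset.sum_comm (f := fun a b => if d = a then σ (Matrix.single b a 1) *
      σ (Matrix.single c b 1) else 0)]
  simp

theorem commute_center (σ : Matrix (Fin k) (Fin k) ℝ →ₗ⁅ℝ⁆ Module.End ℂ V) (c d : Fin k) :
    Commute (∑ a, σ (Matrix.single a a 1)) (σ (Matrix.single c d 1)) := by
  rw [Commute, SemiconjBy, Finset.sum_mul, Finset.mul_sum]
  simp [map_single_mul_comm σ _ _ c d, Finset.sum_add_distrib]

theorem IsIrreducibleOfHighestWeight.eq_smul_one
    {σ : Matrix (Fin k) (Fin k) ℝ →ₗ⁅ℝ⁆ Module.End ℂ V} {lam : Fin k → ℝ}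
    (hσ : IsIrreducibleOfHighestWeight σ lam) {T : Module.End ℂ V}
    (hT : ∀ a b, Commute T (σ (Matrix.single a b 1))) {c : ℂ} {v : V} (hv : v ≠ 0)
    (hTv : T v = c • v) : T = c • 1 := by
  have hinv : ∀ A, ∀ x ∈ LinearMap.ker (T - c • 1), σ A x ∈ LinearMap.ker (T - c • 1) := by
    intro A x hx
    simp only [LinearMap.mem_ker, LinearMap.sub_apply, LinearMap.smul_apply, Module.End.one_apply,
      sub_eq_zero] at hx ⊢
    have h := LinearMap.congr_fun (commute_of_commute_single σ hT A) x
    simp only [Module.End.mul_apply, hx, map_smul] at h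
    exact h
  rcases hσ.irreducible _ hinv with h | h
  · exact absurd ((Submodule.mem_bot ℂ).1 (h ▸ (by simp [hTv] : v ∈ LinearMap.ker (T - c • 1)))) hv
  · exact sub_eq_zero.1 (LinearMap.ker_eq_top.1 h)

/-- The eigenvalue of the Casimir element of `gl(k)` in terms of the highest weight. -/
def glCasimir (lam : Fin k → ℝ) : ℝ :=
  ∑ a, (lam a ^ 2 + ((k : ℝ) - 1 - 2 * (a : ℕ)) * lam a)

theorem sum_ite_eq_glCasimir (lam : Fin k → ℝ) :
    ∑ a, ∑ b, (if a < b then 0 else if a = b then lam a ^ 2 else lam b - lam a) =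
      glCasimir lam := by
  have h : ∀ a b : Fin k, (if a < b then 0 else if a = b then lam a ^ 2 else lam b - lam a) =
      (if a = b then lam a ^ 2 else 0) + ((if b < a then lam b else 0) -
        if b < a then lam a else 0) := by
    intro a b
    rcases lt_trichotomy a b with h | h | h
    · simp [h, h.ne, h.not_gt]
    · simp [h]
    · simp [h, h.ne', h.not_gt]
  simp only [h, Finset.sum_add_distrib, Finset.sum_sub_distrib]
  rw [Finset.sum_comm (f := fun a b : Fin k => if b < a then lam b else 0)]
  simp only [Finset.sum_ite_eq, Finset.mem_univ, if_true]
  simp only [← Finset.sum_filter, Finset.sum_const, nsmul_eq_mul, glCasimir]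
  rw [← Finset.sum_sub_distrib, ← Finset.sum_add_distrib]
  refine Finset.sum_congr rfl fun a _ => ?_
  have h1 : (Finset.univ.filter fun b => a < b).card = k - 1 - (a : ℕ) := by
    rw [← Fin.card_Ioi a]
    congr 1
    ext; simp
  have h2 : (Finset.univ.filter fun b => b < a).card = (a : ℕ) := by
    rw [← Fin.card_Iio a]
    congr 1
    ext; simp
  have h3 : ((k - 1 - (a : ℕ) : ℕ) : ℝ) = (k : ℝ) - 1 - (a : ℕ) := by
    have := a.2
    rw [Nat.cast_sub (by omega), Nat.cast_sub (by omega), Nat.cast_one]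
  rw [h1, h2, h3]
  ring

theorem glCasimir_add_single (lam : Fin k → ℝ) (i : Fin k) :
    glCasimir (lam + Pi.single i 1) = glCasimir lam + (2 * lam i + k - 2 * (i : ℕ)) := by
  rw [← sub_eq_iff_eq_add', glCasimir, glCasimir, ← Finset.sum_sub_distrib,
    Finset.sum_eq_single i]
  · simp
    ring
  · intro a _ ha
    simp [ha]
  · simp

theorem IsIrreducibleOfHighestWeight.casimir_eq
    {σ : Matrix (Fin k) (Fin k) ℝ →ₗ⁅ℝ⁆ Module.End ℂ V} {lam : Fin k → ℝ}
    (hσ : IsIrreducibleOfHighestWeight σ lam) :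
    ∑ a, ∑ b, σ (Matrix.single b a 1) * σ (Matrix.single a b 1) = (glCasimir lam : ℂ) • 1 := by
  obtain ⟨v, hv, hv1, hv2⟩ := hσ.highest
  refine hσ.eq_smul_one (commute_casimir σ) hv ?_
  have h : ∀ a b, σ (Matrix.single b a 1) (σ (Matrix.single a b 1) v) =
      ((if a < b then 0 else if a = b then lam a ^ 2 else lam b - lam a : ℝ) : ℂ) • v := by
    intro a b
    rcases lt_trichotomy a b with h | h | h
    · simp [h, hv2 a b h]
    · subst h
      simp [hv1, smul_smul, pow_two, -Complex.coe_smul]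
    · have h3 := LinearMap.congr_fun (map_single_mul_comm σ a b b a) v
      simp only [Module.End.mul_apply, LinearMap.add_apply, LinearMap.sub_apply, if_true, hv1,
        hv2 b a h, map_zero, zero_add] at h3
      rw [h3, if_neg h.not_gt, if_neg h.ne', ← sub_smul]
      push_cast
      rfl
  simp only [LinearMap.sum_apply, Module.End.mul_apply, h, ← Finset.sum_smul]
  rw [← sum_ite_eq_glCasimir]
  push_cast
  rfl

theorem IsIrreducibleOfHighestWeight.center_eq
    {σ : Matrix (Fin k) (Fin k) ℝ →ₗ⁅ℝ⁆ Module.End ℂ V} {lam : Fin k → ℝ}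
    (hσ : IsIrreducibleOfHighestWeight σ lam) :
    ∑ a, σ (Matrix.single a a 1) = ((∑ a, lam a : ℝ) : ℂ) • 1 := by
  obtain ⟨v, hv, hv1, -⟩ := hσ.highest
  refine hσ.eq_smul_one (commute_center σ) hv ?_
  simp [LinearMap.sum_apply, hv1, ← Finset.sum_smul, -Complex.coe_smul]

end GeneralLinear

/-! ### The Casimir element of `so(n)` on spinors and twistors -/

section Spin

variable {n : ℕ} {S : Type*} [AddCommGroup S] [Module ℂ S]
  (cl : CliffordAlgebra (Q n) →ₐ[ℝ] Module.End ℂ S)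

theorem gam_gam (α β : Fin n) (x : S) :
    gam cl α (gam cl β x) = -gam cl β (gam cl α x) - (if α = β then (2 : ℂ) else 0) • x := by
  have h := LinearMap.congr_fun (gam_mul_add cl α β) x
  rw [LinearMap.add_apply, Module.End.mul_apply, Module.End.mul_apply] at h
  rw [eq_sub_of_add_eq h]
  split_ifs
  · have : (-2 : Module.End ℂ S) x = -((2 : ℂ) • x) := by
      rw [two_smul, LinearMap.neg_apply, Module.End.ofNat_apply, two_nsmul]
    rw [this]
    abel
  · simp

theorem gam_gam_self (α : Fin n) (x : S) : gam cl α (gam cl α x) = -x := by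
  have h := gam_gam cl α α x
  rw [if_pos rfl, eq_sub_iff_add_eq, eq_neg_iff_add_eq_zero] at h
  have h2 : (2 : ℂ) • (gam cl α (gam cl α x) + x) = 0 := by
    rw [← h]
    module
  rw [eq_neg_iff_add_eq_zero]
  exact (smul_eq_zero.1 h2).resolve_left two_ne_zero

theorem spinAction_soF (α β : Fin n) (x : S) :
    spinAction cl (soF α β) x =
      (-(1 / 2) : ℂ) • (gam cl α (gam cl β x) + (if α = β then (1 : ℂ) else 0) • x) := by
  have h : ∀ γ δ, ((-(1 / 4) * (soF α β : Matrix (Fin n) (Fin n) ℝ) γ δ : ℝ) : ℂ) •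
      (gam cl γ (gam cl δ x)) =
      (if α = γ then if β = δ then (-(1 / 4) : ℂ) • gam cl γ (gam cl δ x) else 0 else 0) -
      (if β = γ then if α = δ then (-(1 / 4) : ℂ) • gam cl γ (gam cl δ x) else 0 else 0) := by
    intro γ δ
    rw [soF_coe, Matrix.sub_apply, Matrix.single_apply, Matrix.single_apply, mul_sub,
      Complex.ofReal_sub, sub_smul, ite_and, ite_and]
    congr 1 <;> split_ifs <;> simp
  simp only [spinAction, LinearMap.sum_apply, LinearMap.smul_apply, Module.End.mul_apply, h,
    Finset.sum_sub_distrib]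
  simp only [Finset.sum_ite_irrel, Finset.sum_ite_eq, Finset.mem_univ, if_true,
    Finset.sum_const_zero]
  rw [gam_gam cl β α]
  simp only [eq_comm (a := β)]
  split_ifs <;> module

theorem spinAction_soF_swap (α β : Fin n) (x : S) :
    spinAction cl (soF β α) x = -spinAction cl (soF α β) x := by
  rw [spinAction_soF, spinAction_soF, gam_gam cl β α]
  simp only [eq_comm (a := β)]
  split_ifs <;> module

theorem spinAction_casimir (x : S) :
    ∑ α, ∑ β, spinAction cl (soF β α) (spinAction cl (soF α β) x) =
      (((n : ℝ) * (n - 1) / 4 : ℝ) : ℂ) • x := by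
  have h : ∀ α β : Fin n, spinAction cl (soF β α) (spinAction cl (soF α β) x) =
      (1 / 4 : ℂ) • x - if α = β then (1 / 4 : ℂ) • x else 0 := by
    intro α β
    simp only [spinAction_soF, map_smul, map_add, gam_gam_self, eq_comm (a := β), map_neg]
    split_ifs with h
    · subst h
      simp only [gam_gam_self]
      module
    · module
  simp only [h, Finset.sum_sub_distrib, Finset.sum_ite_eq, Finset.mem_univ, if_true,
    Finset.sum_const, Finset.card_univ, Fintype.card_fin]
  push_cast
  module

theorem sum_soF_smul (α β ν : Fin n) (ψ : Fin n → S) :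
    ∑ μ, (((soF α β : Matrix (Fin n) (Fin n) ℝ) ν μ : ℝ) : ℂ) • ψ μ =
      (if α = ν then ψ β else 0) - if β = ν then ψ α else 0 := by
  simp only [soF_coe, Matrix.sub_apply, Matrix.single_apply, Complex.ofReal_sub, sub_smul,
    Finset.sum_sub_distrib, ite_and]
  congr 1 <;> split_ifs <;> simp

theorem vectorSpinAction_soF (α β ν : Fin n) (ψ : Fin n → S) :
    vectorSpinAction cl (soF α β) ψ ν =
      (if α = ν then ψ β else 0) - (if β = ν then ψ α else 0) + spinAction cl (soF α β) (ψ ν) := by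
  rw [← sum_soF_smul]
  simp [vectorSpinAction]

theorem vectorSpinAction_casimir {ψ : Fin n → S} (hψ : ∑ α, gam cl α (ψ α) = 0) (ν : Fin n) :
    ∑ α, ∑ β, vectorSpinAction cl (soF β α) (vectorSpinAction cl (soF α β) ψ) ν =
      (((n : ℝ) * (n - 1) / 4 + 2 * n : ℝ) : ℂ) • ψ ν := by
  have h1 : ∑ α, spinAction cl (soF ν α) (ψ α) = (-(1 / 2) : ℂ) • ψ ν := by
    simp only [spinAction_soF, ← Finset.smul_sum, Finset.sum_add_distrib, ← map_sum, hψ, map_zero,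
      ite_smul, one_smul, zero_smul, Finset.sum_ite_eq, Finset.mem_univ, if_true, zero_add]
  have h2 : ∑ α, spinAction cl (soF α ν) (ψ α) = (1 / 2 : ℂ) • ψ ν := by
    simp only [spinAction_soF_swap cl ν, Finset.sum_neg_distrib, h1]
    module
  have h3 : ∀ α β, vectorSpinAction cl (soF β α) (vectorSpinAction cl (soF α β) ψ) ν =
      (if β = ν then ψ β - (if β = α then ψ α else 0) + spinAction cl (soF α β) (ψ α) else 0) -
      (if α = ν then (if α = β then ψ β else 0) - ψ α + spinAction cl (soF α β) (ψ β) else 0) +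
      ((if α = ν then spinAction cl (soF β α) (ψ β) else 0) -
        (if β = ν then spinAction cl (soF β α) (ψ α) else 0) +
        spinAction cl (soF β α) (spinAction cl (soF α β) (ψ ν))) := by
    intro α β
    simp only [vectorSpinAction_soF, if_true, map_add, map_sub, apply_ite (spinAction cl _),
      map_zero]
  simp only [h3, Finset.sum_add_distrib, Finset.sum_sub_distrib, spinAction_casimir,
    Finset.sum_ite_irrel, Finset.sum_ite_eq, Finset.sum_ite_eq', Finset.mem_univ, if_true,
    Finset.sum_const_zero, h1, h2, Finset.sum_const, Finset.card_univ, Fintype.card_fin]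
  push_cast
  module

theorem halfSpinAction_zero (s : ℤˣ) : halfSpinAction cl s 0 = 0 := by
  ext x
  change spinAction cl 0 x.1 = 0
  simp [spinAction]

theorem twistorAction_zero (s : ℤˣ) : twistorAction cl s 0 = 0 := by
  ext x
  change vectorSpinAction cl 0 x.1 _ = 0
  simp [vectorSpinAction, spinAction]

theorem halfSpinAction_casimir (s : ℤˣ) :
    ∑ α, ∑ β, halfSpinAction cl s (soF β α) * halfSpinAction cl s (soF α β) =
      (((n : ℝ) * (n - 1) / 4 : ℝ) : ℂ) • 1 := by
  refine LinearMap.ext fun x => Subtype.ext ?_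
  simp only [LinearMap.sum_apply, AddSubmonoidClass.coe_finsetSum]
  exact spinAction_casimir cl x.1

theorem twistorAction_casimir (s : ℤˣ) :
    ∑ α, ∑ β, twistorAction cl s (soF β α) * twistorAction cl s (soF α β) =
      (((n : ℝ) * (n - 1) / 4 + 2 * n : ℝ) : ℂ) • 1 := by
  refine LinearMap.ext fun x => Subtype.ext (funext fun ν => ?_)
  simp only [LinearMap.sum_apply, AddSubmonoidClass.coe_finsetSum, Finset.sum_apply]
  exact vectorSpinAction_casimir cl x.2.2 ν

end Spin

/-! ### Symmetric weights -/

theorem lt_rowLen_comm {Y : YoungDiagram} (hY : Y.transpose = Y) (a b : ℕ) :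
    b < Y.rowLen a ↔ a < Y.rowLen b := by
  rw [← YoungDiagram.mem_iff_lt_rowLen, ← YoungDiagram.mem_iff_lt_rowLen]
  conv_lhs => rw [← hY]
  rw [YoungDiagram.mem_transpose]
  rfl

/-- If adding boxes in rows `i < j` preserves the symmetry of a symmetric Young diagram, then the
two boxes are exchanged by the transposition. -/
theorem IsSymmetricWeight.apply_eq {n k : ℕ} {lam : Fin k → ℝ} {i j : Fin k} (hij : i < j)
    (h : IsSymmetricWeight n k lam)
    (h' : IsSymmetricWeight n k (lam + Pi.single i 1 + Pi.single j 1)) :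
    lam i = ((n : ℝ) - 1) / 2 + (j : ℕ) ∧ lam j = ((n : ℝ) - 1) / 2 + (i : ℕ) := by
  obtain ⟨Y, hY, hYk, hlam⟩ := h
  obtain ⟨Y', hY', hYk', hlam'⟩ := h'
  have hi : Y'.rowLen i = Y.rowLen i + 1 := by
    have := hlam' i
    rw [Pi.add_apply, Pi.add_apply, Pi.single_eq_same, Pi.single_eq_of_ne hij.ne, hlam] at this
    exact_mod_cast (by linarith : (Y'.rowLen i : ℝ) = Y.rowLen i + 1)
  have hj : Y'.rowLen j = Y.rowLen j + 1 := by
    have := hlam' j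
    rw [Pi.add_apply, Pi.add_apply, Pi.single_eq_same, Pi.single_eq_of_ne hij.ne', hlam] at this
    exact_mod_cast (by linarith : (Y'.rowLen j : ℝ) = Y.rowLen j + 1)
  have hne : ∀ a : ℕ, a ≠ i → a ≠ j → Y'.rowLen a = Y.rowLen a := by
    intro a hai haj
    rcases le_or_gt k a with hk | hk
    · rw [hYk a hk, hYk' a hk]
    · have hai' : (⟨a, hk⟩ : Fin k) ≠ i := fun h => hai (congrArg Fin.val h)
      have haj' : (⟨a, hk⟩ : Fin k) ≠ j := fun h => haj (congrArg Fin.val h)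
      have := hlam' ⟨a, hk⟩
      rw [Pi.add_apply, Pi.add_apply, Pi.single_eq_of_ne hai', Pi.single_eq_of_ne haj',
        hlam] at this
      exact_mod_cast (by linarith : (Y'.rowLen a : ℝ) = Y.rowLen a)
  have hij' : (i : ℕ) < j := hij
  have hanti : Y.rowLen j ≤ Y.rowLen i := Y.rowLen_anti _ _ hij'.le
  have key : ∀ a : ℕ, Y'.rowLen a = Y.rowLen a + 1 → Y.rowLen a = i ∨ Y.rowLen a = j := by
    intro a ha
    by_contra! hcon
    have h1 := hne _ hcon.1 hcon.2
    have h2 := (lt_rowLen_comm hY' a (Y.rowLen a)).1 (by omega)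
    rw [h1] at h2
    exact lt_irrefl _ ((lt_rowLen_comm hY a (Y.rowLen a)).2 h2)
  have main : Y.rowLen i = j ∧ Y.rowLen j = i := by
    have s1 := lt_rowLen_comm hY i j
    have s1' := lt_rowLen_comm hY' i j
    have s2 := lt_rowLen_comm hY i i
    have s3 := lt_rowLen_comm hY j j
    rcases key i hi with h1 | h1 <;> rcases key j hj with h2 | h2 <;> omega
  constructor
  · rw [hlam, main.1]
  · rw [hlam, main.2]

end KDirac

end

theorem mainTheorem3 (n k : ℕ) (hk : 2 ≤ k) (hn : 2 * k ≤ n) (hn2 : Even n)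
    (i j : Fin k) (hij : i < j) (lam : Fin k → ℝ)
    (hlam : KDirac.IsSymmetricWeight n k lam)
    (hlam' : KDirac.IsSymmetricWeight n k (lam + Pi.single i 1 + Pi.single j 1))
    {V Vi Vj S : Type*} [AddCommGroup V] [Module ℂ V] [AddCommGroup Vi] [Module ℂ Vi]
    [AddCommGroup Vj] [Module ℂ Vj] [AddCommGroup S] [Module ℂ S]
    (σ : Matrix (Fin k) (Fin k) ℝ →ₗ⁅ℝ⁆ Module.End ℂ V)
    (σi : Matrix (Fin k) (Fin k) ℝ →ₗ⁅ℝ⁆ Module.End ℂ Vi)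
    (σj : Matrix (Fin k) (Fin k) ℝ →ₗ⁅ℝ⁆ Module.End ℂ Vj)
    (hσ : KDirac.IsIrreducibleOfHighestWeight σ lam)
    (hσi : KDirac.IsIrreducibleOfHighestWeight σi (lam + Pi.single i 1))
    (hσj : KDirac.IsIrreducibleOfHighestWeight σj (lam + Pi.single j 1))
    (cl : CliffordAlgebra (KDirac.Q n) →ₐ[ℝ] Module.End ℂ S)
    (hcl : KDirac.IsSpinorModule cl)
    (s : ℤˣ) (t : ℝ) (ht : t ≠ 0) :
    ∃ c cSi cSj cTi cTj : ℝ,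
      KDirac.CasimirActsBy t (KDirac.leviAction σ (KDirac.halfSpinAction cl s)) c ∧
      KDirac.CasimirActsBy t (KDirac.leviAction σi (KDirac.halfSpinAction cl (-s))) cSi ∧
      KDirac.CasimirActsBy t (KDirac.leviAction σj (KDirac.halfSpinAction cl (-s))) cSj ∧
      KDirac.CasimirActsBy t (KDirac.leviAction σi (KDirac.twistorAction cl s)) cTi ∧
      KDirac.CasimirActsBy t (KDirac.leviAction σj (KDirac.twistorAction cl s)) cTj ∧
      c - cSi = 1 / (2 * t) * (2 * (lam j - lam i) / (n + 2 * k - 2)) ∧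
      c - cSj = 1 / (2 * t) * (2 * (lam i - lam j) / (n + 2 * k - 2)) ∧
      c - cTi = 1 / (2 * t) * ((2 * (lam j - lam i) - n) / (n + 2 * k - 2)) ∧
      c - cTj = 1 / (2 * t) * ((2 * (lam i - lam j) - n) / (n + 2 * k - 2)) := by
  have hn4 : 4 ≤ n := by omega
  have hN : (n : ℝ) + 2 * k - 2 ≠ 0 := by
    have h1 : (4 : ℝ) ≤ n := by exact_mod_cast hn4
    have h2 : (0 : ℝ) ≤ k := k.cast_nonneg
    linarith
  obtain ⟨hi, hj⟩ := hlam.apply_eq hij hlam'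
  have hsum : ∀ a : Fin k, ∑ b, (lam + Pi.single a 1 : Fin k → ℝ) b = ∑ b, lam b + 1 := by
    intro a
    simp [Finset.sum_add_distrib]
  refine ⟨_, _, _, _, _,
    KDirac.casimirActsBy_leviAction ht hN σ _ (KDirac.halfSpinAction_zero cl s)
      hσ.casimir_eq hσ.center_eq (KDirac.halfSpinAction_casimir cl s),
    KDirac.casimirActsBy_leviAction ht hN σi _ (KDirac.halfSpinAction_zero cl (-s))
      hσi.casimir_eq hσi.center_eq (KDirac.halfSpinAction_casimir cl (-s)),
    KDirac.casimirActsBy_leviAction ht hN σj _ (KDirac.halfSpinAction_zero cl (-s))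
      hσj.casimir_eq hσj.center_eq (KDirac.halfSpinAction_casimir cl (-s)),
    KDirac.casimirActsBy_leviAction ht hN σi _ (KDirac.twistorAction_zero cl s)
      hσi.casimir_eq hσi.center_eq (KDirac.twistorAction_casimir cl s),
    KDirac.casimirActsBy_leviAction ht hN σj _ (KDirac.twistorAction_zero cl s)
      hσj.casimir_eq hσj.center_eq (KDirac.twistorAction_casimir cl s), ?_, ?_, ?_, ?_⟩ <;>
  · rw [KDirac.glCasimir_add_single, hsum, hi, hj]
    field_simp
    ring
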